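/- Let $(\varepsilon_{j,k})_{j\ge 0,\,0\le k\le 2^j-1}$ be independent standard Gaussian random variables on a probability space $(\Omega,\mathcal F,\mathbb P)$. Let $H_j:[0,1]\to[\underline H,\overline H]\subset(0,1)$, $j\ge 0$, be Lipschitz functions for which there is a constant $C>0$ such that, for all $j\ge 0$, \[\sup_{x\in[0,1]}|H_j(x)|+\sup_{0\le x'<x''\le 1}\frac{|H_j(x'')-H_j(x')|}{x''-x'}\le C(1+j),\] and suppose that \[H(t):=\liminf_{j\to+\infty}H_j(t)<\underline H+\tfrac12\qquad\text{for all }t\in(0,1).\] Let $h_{j,k}(s)=2^{j/2}h(2^js-k)$, where $h=\mathbf 1_{[0,1/2)}-\mathbf 1_{[1/2,1)}$, and let $(y)_+^\beta=y^\beta$ for $y\ge 0$ and $(y)_+^\beta=0$ for $y<0$. Let $\{X(t),\,t\in[0,1]\}$ be (any version of) the Gaussian Haar-based multifractional process, that is, for each $t\in[0,1]$, almost surely, \[X(t)=\sum_{j=0}^{+\infty}\sum_{k=0}^{2^j-1}\left(\int_0^1 (t-s)_+^{H_j(k/2^j)-1/2}\,h_{j,k}(s)\,ds\right)\varepsilon_{j,k},\]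 where the series is summed in $L^2(\mathbb P)$. For $t\in[0,1]$ let \[\alpha_X(t)=\sup\left\{\alpha\ge 0:\ \limsup_{h\to 0}\frac{|X(t+h)-X(t)|}{|h|^{\alpha}}=0\right\}\in[0,+\infty]\] be the pointwise Hölder exponent of the path of $X$ at $t$ (with $\sup\emptyset=0$, and only $h\neq 0$ with $t+h\in[0,1]$ considered). Then there is an event $\Omega_2^*$ with $\mathbb P(\Omega_2^*)=1$, not depending on $t$, such that on $\Omega_2^*$ \[\alpha_X(t)\le H(t)\qquad\text{for all }t\in(0,1).\] -/

import Mathlib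

open MeasureTheory ProbabilityTheory Set Filter Topology
open scoped NNReal ENNReal

noncomputable section

namespace GHBMP

/-- The truncated power `(y)_+^β`: it is `y ^ β` for `y ≥ 0` and `0` for `y < 0`. -/
def posPow (y β : ℝ) : ℝ := if 0 ≤ y then y ^ β else 0

/-- The Haar mother wavelet `1_{[0,1/2)} - 1_{[1/2,1)}`. -/
def haar (s : ℝ) : ℝ :=
  (Ico (0 : ℝ) (1 / 2)).indicator (fun _ => (1 : ℝ)) s
    - (Ico (1 / 2 : ℝ) 1).indicator (fun _ => (1 : ℝ)) s

/-- The Haar functions `h_{j,k}(s) = 2^{j/2} h(2^j s - k)`. -/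
def haarJK (j k : ℕ) (s : ℝ) : ℝ :=
  (2 : ℝ) ^ ((j : ℝ) / 2) * haar ((2 : ℝ) ^ j * s - k)

/-- The norm `sup_{[0,1]} |f| + sup_{0 ≤ x < y ≤ 1} |f y - f x| / (y - x)`, with values in
`[0, ∞]`; it is finite exactly when `f` is Lipschitz on `[0,1]`. -/
def lipNorm (f : ℝ → ℝ) : ℝ≥0∞ :=
  (⨆ x ∈ Icc (0 : ℝ) 1, ENNReal.ofReal |f x|)
    + ⨆ x ∈ Icc (0 : ℝ) 1, ⨆ y ∈ Icc (0 : ℝ) 1, ⨆ _ : x < y,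
        ENNReal.ofReal (|f y - f x| / (y - x))

/-- The index set of the Haar system: pairs `(j, k)` with `0 ≤ k ≤ 2^j - 1`. -/
abbrev Idx : Type := Σ j : ℕ, Fin (2 ^ j)

/-- The deterministic coefficient
`∫_0^1 (t - s)_+^{H_j(k / 2^j) - 1/2} h_{j,k}(s) ds`. -/
def coef (H : ℕ → ℝ → ℝ) (j k : ℕ) (t : ℝ) : ℝ :=
  ∫ s in (0 : ℝ)..1, posPow (t - s) (H j ((k : ℝ) / 2 ^ j) - 1 / 2) * haarJK j k s

/-- `ε` is a family of independent standard Gaussian random variables. -/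
structure IsStdGaussianFamily {Ω : Type*} [MeasurableSpace Ω] (P : Measure Ω)
    (ε : Idx → Ω → ℝ) : Prop where
  measurable : ∀ i, Measurable (ε i)
  law : ∀ i, P.map (ε i) = gaussianReal 0 1
  indep : iIndepFun ε P

theorem IsStdGaussianFamily.memLp {Ω : Type*} [MeasurableSpace Ω] {P : Measure Ω}
    {ε : Idx → Ω → ℝ} (hε : IsStdGaussianFamily P ε) (i : Idx) : MemLp (ε i) 2 P := by
  have h : MemLp (id : ℝ → ℝ) 2 (P.map (ε i)) := by
    rw [hε.law i]
    exact memLp_id_gaussianReal 2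
  exact h.comp_of_map (hε.measurable i).aemeasurable

/-- The random variable
`∑_j ∑_{k < 2^j} (∫_0^1 (t - s)_+^{H_j(k / 2^j) - 1/2} h_{j,k}(s) ds) ε_{j,k}`,
the sum of the series being taken in `L²(P)`. -/
def seriesL2 {Ω : Type*} [MeasurableSpace Ω] {P : Measure Ω} (H : ℕ → ℝ → ℝ)
    {ε : Idx → Ω → ℝ} (hε : IsStdGaussianFamily P ε) (t : ℝ) : Lp ℝ 2 P :=
  ∑' j : ℕ, ∑ k : Fin (2 ^ j), coef H j k t • (hε.memLp ⟨j, k⟩).toLp (ε ⟨j, k⟩)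

/-- `X` is a Gaussian Haar-based multifractional process: for each `t ∈ [0,1]` the random
variable `X t` is (almost surely equal to) the sum of the series. So `X` is any version of the
process, in particular one with continuous paths. -/
def IsGHBMP {Ω : Type*} [MeasurableSpace Ω] {P : Measure Ω} (H : ℕ → ℝ → ℝ)
    {ε : Idx → Ω → ℝ} (hε : IsStdGaussianFamily P ε) (X : ℝ → Ω → ℝ) : Prop :=
  ∀ t ∈ Icc (0 : ℝ) 1, X t =ᵐ[P] seriesL2 H hε t

/-- The pointwise Hölder exponent at `t` of a function `x` on `[0,1]`,
`sup {α ≥ 0 : limsup_{h → 0} |x (t + h) - x t| / |h|^α = 0}`, with values in `[0, ∞]`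
and over increments `h ≠ 0` with `t + h ∈ [0,1]`. -/
def holderExponent (x : ℝ → ℝ) (t : ℝ) : ℝ≥0∞ :=
  ⨆ (α : ℝ≥0) (_ : limsup
      (fun h : ℝ => ENNReal.ofReal (|x (t + h) - x t| / |h| ^ (α : ℝ)))
      (𝓝[{h : ℝ | h ≠ 0 ∧ t + h ∈ Icc (0 : ℝ) 1}] 0) = 0), (α : ℝ≥0∞)

/-- The Hurst function `H(t) = liminf_j H_j(t)`. -/
def hurst (H : ℕ → ℝ → ℝ) (t : ℝ) : ℝ := liminf (fun j => H j t) atTop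

end GHBMP

end

/-!
Two features of the series carry the proof. By self-similarity (`GHBMP.coef_eq`) the coefficient
of `ε_{j,k}` at the midpoint of the dyadic cell `[k / 2^j, (k + 1) / 2^j)` is at least
`2^(-j H_j(k / 2^j)) / 8`; by causality (`GHBMP.coef_of_le`) it vanishes at all times up to
`k / 2^j`. So the increment of `X` over the first half of that cell is the sum of a multiple of
`ε_{j,k}`, of size at least `2^(-j H_j(k / 2^j)) / 8`, and of a variable determined by the other
coordinates, and the increments over earlier cells do not involve `ε_{j,k}`. The law of `ε_{j,k}`
has density at most `1`, and an independent shift does not increase a small ball bound; hence, if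
`H_j ≤ p` at `N` consecutive nodes of level `j`, all `N` increments are at most `η` with
probability at most `(16 η 2^(j p))^N` (`GHBMP.measure_increments_le`).

For `η = 2 (N / 2^j)^q` with `p < q` this is a constant times `2^(-j N (q - p))`. When
`N (q - p) ≥ 2` the bound survives the sum over the `2^j` positions and over `j`, and
the Borel–Cantelli lemma shows that almost surely, at all large levels, every such run of cells
contains an increment larger than `2 (N / 2^j)^q`
(`GHBMP.ae_eventually_exists_increment_gt`). Letting `p < q` run through the rationals gives an
event that does not depend on `t`. Only dyadic times are sampled, which is why any version of the
process will do.

On this event, suppose that the exponent at `t` exceeds `H(t)`, and choose `H(t) < p < q` below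
it. At infinitely many levels `H_j(t)` is smaller than `p` by a fixed margin, and the Lipschitz
bound `C (1 + j)` gives `H_j ≤ p` at the nodes of `N` consecutive cells, the first
containing `t`. One of the increments there exceeds `2 (N / 2^j)^q`, whereas both of its endpoints
are within `N / 2^j` of `t`, so that it is at most `2 (N / 2^j)^q` (`GHBMP.holderExponent_le_hurst`).

The series has to converge in `L²(P)` for `seriesL2` to be its sum (`GHBMP.summable_seriesL2`):
the variables `ε_{j,k}` are orthonormal, and the coefficients decay like `n^(Hupp - 3/2)` in the
distance `n` of the cell from `2^j t`, which is square summable as `Hupp < 1`.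
-/

namespace GHBMP

/-! ### The coefficients of the series -/

/-- The primitive `(y)_+^a / a` of the truncated power `(y)_+^(a - 1)`, for `a > 0`. -/
noncomputable def truncPrim (a y : ℝ) : ℝ := (max y 0) ^ a / a

/-- The fractional primitive of the Haar mother wavelet: for `a > 0`, the second difference of
`truncPrim a` at `x` equals `∫ (x - u)_+^(a - 1) h(u) du`. -/
noncomputable def haarPrim (a x : ℝ) : ℝ :=
  truncPrim a x - 2 * truncPrim a (x - 1 / 2) + truncPrim a (x - 1)

lemma truncPrim_of_nonpos {a y : ℝ} (ha : 0 < a) (hy : y ≤ 0) : truncPrim a y = 0 := by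
  simp [truncPrim, max_eq_right hy, Real.zero_rpow ha.ne']

lemma truncPrim_of_nonneg {a y : ℝ} (hy : 0 ≤ y) : truncPrim a y = y ^ a / a := by
  simp [truncPrim, max_eq_left hy]

lemma truncPrim_mul {a c : ℝ} (hc : 0 ≤ c) (y : ℝ) :
    truncPrim a (c * y) = c ^ a * truncPrim a y := by
  have : max (c * y) 0 = c * max y 0 := by rw [mul_max_of_nonneg _ _ hc, mul_zero]
  rw [truncPrim, truncPrim, this, Real.mul_rpow hc (le_max_right _ _), mul_div_assoc]

lemma continuous_truncPrim {a : ℝ} (ha : 0 < a) : Continuous (truncPrim a) := by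
  unfold truncPrim
  exact ((continuous_id.max continuous_const).rpow_const fun _ => Or.inr ha.le).div_const a

lemma hasDerivAt_truncPrim {b y : ℝ} (hb : -1 < b) (hy : y ≠ 0) :
    HasDerivAt (truncPrim (b + 1)) (posPow y b) y := by
  have hb' : b + 1 ≠ 0 := by linarith
  rcases lt_or_gt_of_ne hy with h | h
  · rw [posPow, if_neg (not_le.2 h)]
    refine (hasDerivAt_const y (0 : ℝ)).congr_of_eventuallyEq ?_
    filter_upwards [Iio_mem_nhds h] with z hz
    exact truncPrim_of_nonpos (by linarith) (le_of_lt hz)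
  · rw [posPow, if_pos h.le]
    have h1 := (Real.hasDerivAt_rpow_const (p := b + 1) (Or.inl hy)).div_const (b + 1)
    rw [add_sub_cancel_right, mul_div_cancel_left₀ _ hb'] at h1
    refine h1.congr_of_eventuallyEq ?_
    filter_upwards [Ioi_mem_nhds h] with z hz
    exact truncPrim_of_nonneg (le_of_lt hz)

lemma intervalIntegrable_posPow {b : ℝ} (hb : -1 < b) (p q : ℝ) :
    IntervalIntegrable (fun y => posPow y b) volume p q := by
  have h := intervalIntegral.intervalIntegrable_rpow' (a := p) (b := q) hb
  have e : (fun y => posPow y b) = (Ici (0 : ℝ)).indicator fun y => y ^ b := by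
    ext y
    by_cases hy : 0 ≤ y <;> simp [posPow, hy]
  rw [e]
  exact ⟨h.1.indicator measurableSet_Ici, h.2.indicator measurableSet_Ici⟩

lemma integral_posPow {b : ℝ} (hb : -1 < b) (p q : ℝ) :
    ∫ y in p..q, posPow y b = truncPrim (b + 1) q - truncPrim (b + 1) p :=
  integral_eq_of_hasDerivAt_off_countable _ _ (countable_singleton (0 : ℝ))
    (continuous_truncPrim (by linarith)).continuousOn
    (fun _ hx => hasDerivAt_truncPrim hb hx.2) (intervalIntegrable_posPow hb p q)

lemma intervalIntegrable_posPow_sub {b : ℝ} (hb : -1 < b) (t p q : ℝ) :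
    IntervalIntegrable (fun s => posPow (t - s) b) volume p q := by
  simpa using (intervalIntegrable_posPow hb (t - p) (t - q)).comp_sub_left (c := t)

lemma integral_posPow_sub {b : ℝ} (hb : -1 < b) (t p q : ℝ) :
    ∫ s in p..q, posPow (t - s) b = truncPrim (b + 1) (t - p) - truncPrim (b + 1) (t - q) := by
  rw [intervalIntegral.integral_comp_sub_left (fun y => posPow y b) t, integral_posPow hb]

lemma haarJK_left {j k : ℕ} {s : ℝ} (h : s < k / 2 ^ j) : haarJK j k s = 0 := by
  have hp : (0 : ℝ) < 2 ^ j := by positivity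
  have : (2 : ℝ) ^ j * s < k := by rwa [lt_div_iff₀ hp, mul_comm] at h
  rw [haarJK, haar, indicator_of_notMem, indicator_of_notMem] <;> simp <;> intros <;> linarith

lemma haarJK_right {j k : ℕ} {s : ℝ} (h : (k + 1) / 2 ^ j < s) : haarJK j k s = 0 := by
  have hp : (0 : ℝ) < 2 ^ j := by positivity
  have : (k : ℝ) + 1 < (2 : ℝ) ^ j * s := by rwa [div_lt_iff₀ hp, mul_comm] at h
  rw [haarJK, haar, indicator_of_notMem, indicator_of_notMem] <;> simp <;> intros <;> linarith

lemma haarJK_first {j k : ℕ} {s : ℝ} (h : k / 2 ^ j < s) (h' : s < (k + 1 / 2) / 2 ^ j) :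
    haarJK j k s = 2 ^ ((j : ℝ) / 2) := by
  have hp : (0 : ℝ) < 2 ^ j := by positivity
  have h1 : (k : ℝ) < (2 : ℝ) ^ j * s := by rwa [div_lt_iff₀ hp, mul_comm] at h
  have h2 : (2 : ℝ) ^ j * s < k + 1 / 2 := by rwa [lt_div_iff₀ hp, mul_comm] at h'
  rw [haarJK, haar, indicator_of_mem, indicator_of_notMem]
  · ring
  · rw [mem_Ico]; intro h; linarith [h.1]
  · constructor <;> linarith

lemma haarJK_second {j k : ℕ} {s : ℝ} (h : (k + 1 / 2) / 2 ^ j < s) (h' : s < (k + 1) / 2 ^ j) :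
    haarJK j k s = -2 ^ ((j : ℝ) / 2) := by
  have hp : (0 : ℝ) < 2 ^ j := by positivity
  have h1 : (k : ℝ) + 1 / 2 < (2 : ℝ) ^ j * s := by rwa [div_lt_iff₀ hp, mul_comm] at h
  have h2 : (2 : ℝ) ^ j * s < k + 1 := by rwa [lt_div_iff₀ hp, mul_comm] at h'
  rw [haarJK, haar, indicator_of_notMem, indicator_of_mem]
  · ring
  · constructor <;> linarith
  · rw [mem_Ico]; intro h; linarith [h.2]

/-- Closed form of the coefficients, which exhibits their self-similarity. -/
lemma coef_eq {H : ℕ → ℝ → ℝ} {j k : ℕ} (hk : k < 2 ^ j) (hH : 0 < H j (k / 2 ^ j)) (t : ℝ) :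
    coef H j k t = 2 ^ (-(j * H j (k / 2 ^ j)))
      * haarPrim (H j (k / 2 ^ j) + 1 / 2) (2 ^ j * t - k) := by
  set h := H j (k / 2 ^ j) with hh
  have hb : -1 < h - 1 / 2 := by linarith
  have hp : (0 : ℝ) < 2 ^ j := by positivity
  have hk' : (k : ℝ) + 1 ≤ 2 ^ j := by exact_mod_cast hk
  set u : ℝ := k / 2 ^ j with hu
  set v : ℝ := (k + 1 / 2) / 2 ^ j with hv
  set w : ℝ := (k + 1) / 2 ^ j with hw
  have u0 : 0 ≤ u := by positivity
  have uv : u ≤ v := by rw [hu, hv]; gcongr; linarith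
  have vw : v ≤ w := by rw [hw, hv]; gcongr; norm_num
  have w1 : w ≤ 1 := by rw [hw, div_le_one hp]; exact hk'
  have e1 : EqOn (fun s => posPow (t - s) (h - 1 / 2) * haarJK j k s) (fun _ => 0) (uIoo 0 u) := by
    intro s hs; rw [uIoo_of_le u0] at hs; simp [haarJK_left hs.2]
  have e2 : EqOn (fun s => posPow (t - s) (h - 1 / 2) * haarJK j k s)
      (fun s => posPow (t - s) (h - 1 / 2) * 2 ^ ((j : ℝ) / 2)) (uIoo u v) := by
    intro s hs; rw [uIoo_of_le uv] at hs; simp only [haarJK_first hs.1 hs.2]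
  have e3 : EqOn (fun s => posPow (t - s) (h - 1 / 2) * haarJK j k s)
      (fun s => posPow (t - s) (h - 1 / 2) * (-2 ^ ((j : ℝ) / 2))) (uIoo v w) := by
    intro s hs; rw [uIoo_of_le vw] at hs; simp only [haarJK_second hs.1 hs.2]
  have e4 : EqOn (fun s => posPow (t - s) (h - 1 / 2) * haarJK j k s) (fun _ => 0) (uIoo w 1) := by
    intro s hs; rw [uIoo_of_le w1] at hs; simp [haarJK_right hs.1]
  have i1 := (intervalIntegrable_const (μ := volume) (a := (0 : ℝ)) (b := u)
    (c := (0 : ℝ))).congr_uIoo e1.symm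
  have i2 := ((intervalIntegrable_posPow_sub hb t u v).mul_const _).congr_uIoo e2.symm
  have i3 := ((intervalIntegrable_posPow_sub hb t v w).mul_const _).congr_uIoo e3.symm
  have i4 := (intervalIntegrable_const (μ := volume) (a := w) (b := (1 : ℝ))
    (c := (0 : ℝ))).congr_uIoo e4.symm
  have key : coef H j k t = 2 ^ ((j : ℝ) / 2) * (truncPrim (h + 1 / 2) (t - u)
      - 2 * truncPrim (h + 1 / 2) (t - v) + truncPrim (h + 1 / 2) (t - w)) := by
    rw [coef, ← hu, ← hh,
      ← intervalIntegral.integral_add_adjacent_intervals ((i1.trans i2).trans i3) i4,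
      ← intervalIntegral.integral_add_adjacent_intervals (i1.trans i2) i3,
      ← intervalIntegral.integral_add_adjacent_intervals i1 i2,
      intervalIntegral.integral_congr_uIoo e1, intervalIntegral.integral_congr_uIoo e2,
      intervalIntegral.integral_congr_uIoo e3, intervalIntegral.integral_congr_uIoo e4,
      intervalIntegral.integral_mul_const, intervalIntegral.integral_mul_const,
      integral_posPow_sub hb, integral_posPow_sub hb, show h - 1 / 2 + 1 = h + 1 / 2 by ring]
    simp only [intervalIntegral.integral_const, smul_zero]
    ring
  have hs : ∀ z : ℝ, truncPrim (h + 1 / 2) (t - (k + z) / 2 ^ j)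
      = (2 ^ (-(j : ℝ))) ^ (h + 1 / 2) * truncPrim (h + 1 / 2) (2 ^ j * t - k - z) := by
    intro z
    rw [← truncPrim_mul (by positivity), Real.rpow_neg zero_le_two, Real.rpow_natCast]
    congr 1; field_simp; ring
  have hs0 := hs 0
  rw [add_zero, sub_zero] at hs0
  rw [key, hu, hv, hw, hs0, hs, hs, haarPrim, ← Real.rpow_mul zero_le_two,
    show -((j : ℝ) * h) = j / 2 + -j * (h + 1 / 2) by ring, Real.rpow_add two_pos]
  ring

lemma haarPrim_of_nonpos {a x : ℝ} (ha : 0 < a) (hx : x ≤ 0) : haarPrim a x = 0 := by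
  rw [haarPrim, truncPrim_of_nonpos ha hx, truncPrim_of_nonpos ha (by linarith),
    truncPrim_of_nonpos ha (by linarith)]
  norm_num

/-- The value at `1 / 2` is bounded below, whereas the value at `1` vanishes for `a = 1`. -/
lemma le_haarPrim_half {a : ℝ} (ha : 0 < a) (ha' : a ≤ 3 / 2) : 1 / 8 ≤ haarPrim a (1 / 2) := by
  rw [haarPrim, truncPrim_of_nonpos ha (show (1 / 2 : ℝ) - 1 / 2 ≤ 0 by norm_num),
    truncPrim_of_nonpos ha (show (1 / 2 : ℝ) - 1 ≤ 0 by norm_num),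
    truncPrim_of_nonneg (by norm_num)]
  have h1 : (1 / 2 : ℝ) ^ (2 : ℝ) ≤ (1 / 2) ^ a :=
    Real.rpow_le_rpow_of_exponent_ge (by norm_num) (by norm_num) (by linarith)
  have h2 : (1 / 2 : ℝ) ^ (2 : ℝ) = 1 / 4 := by norm_num
  have : (1 / 8 : ℝ) ≤ (1 / 2) ^ a / a := by rw [le_div_iff₀ ha]; linarith
  linarith

/-- Away from the origin the second difference behaves like a second derivative. -/
lemma abs_haarPrim_le_of_one_lt {a x : ℝ} (ha : 0 < a) (ha' : a < 3 / 2) (hx : 1 < x) :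
    |haarPrim a x| ≤ (x - 1) ^ (a - 2) := by
  have d0 : ∀ y : ℝ, 0 < y → HasDerivAt (truncPrim a) (y ^ (a - 1)) y := by
    intro y hy
    have := hasDerivAt_truncPrim (b := a - 1) (by linarith) hy.ne'
    rwa [sub_add_cancel, posPow, if_pos hy.le] at this
  have d1 : ∀ y : ℝ, 1 / 2 < y → HasDerivAt (fun y => truncPrim a y - truncPrim a (y - 1 / 2))
      (y ^ (a - 1) - (y - 1 / 2) ^ (a - 1)) y := fun y hy =>
    (d0 y (by linarith)).sub ((d0 (y - 1 / 2) (by linarith)).comp_sub_const y (1 / 2))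
  obtain ⟨ξ, hξ, h1⟩ := exists_hasDerivAt_eq_slope _ _ (show x - 1 / 2 < x by linarith)
    (fun y hy => (d1 y (by linarith [hy.1])).continuousAt.continuousWithinAt)
    (fun y hy => d1 y (by linarith [hy.1]))
  have d2 : ∀ y : ℝ, 0 < y → HasDerivAt (fun y : ℝ => y ^ (a - 1))
      ((a - 1) * y ^ (a - 1 - 1)) y := fun y hy =>
    Real.hasDerivAt_rpow_const (Or.inl hy.ne')
  have hξ0 : 0 < ξ - 1 / 2 := by linarith [hξ.1]
  obtain ⟨ζ, hζ, h2⟩ := exists_hasDerivAt_eq_slope _ _ (show ξ - 1 / 2 < ξ by linarith)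
    (fun y hy => (d2 y (by linarith [hy.1])).continuousAt.continuousWithinAt)
    (fun y hy => d2 y (by linarith [hy.1]))
  have hζ1 : x - 1 ≤ ζ := by linarith [hζ.1, hξ.1]
  have e : haarPrim a x = (a - 1) * ζ ^ (a - 2) / 4 := by
    rw [show a - 1 - 1 = a - 2 by ring] at h2
    rw [haarPrim, h2]
    have : ξ ^ (a - 1) - (ξ - 1 / 2) ^ (a - 1) = 2 * haarPrim a x := by
      rw [h1, haarPrim]; ring_nf
    rw [this, haarPrim]; ring_nf
  have h3 : ζ ^ (a - 2) ≤ (x - 1) ^ (a - 2) :=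
    Real.rpow_le_rpow_of_nonpos (by linarith) hζ1 (by linarith)
  have h4 : 0 ≤ ζ ^ (a - 2) := Real.rpow_nonneg (by linarith) _
  rw [e, abs_div, abs_mul, abs_of_nonneg h4, abs_of_pos (show (0 : ℝ) < 4 by norm_num)]
  have h5 : |a - 1| ≤ 1 := by rw [abs_le]; constructor <;> linarith
  nlinarith

/-- The decay is square summable in `n`, since `h < 1`. -/
lemma abs_haarPrim_le {a h x : ℝ} {n : ℕ} (ha : 1 / 2 < a) (hah : a ≤ h + 1 / 2) (hh : h < 1)
    (hn : n ≤ x) (hn' : x < n + 1) : |haarPrim a x| ≤ 128 * ((n : ℝ) + 1) ^ (h - 3 / 2) := by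
  have ha0 : 0 < a := by linarith
  rcases le_or_gt 2 n with h2 | h2
  · have h2' : (2 : ℝ) ≤ n := by exact_mod_cast h2
    have hb : (0 : ℝ) < (n + 1) / 3 := by positivity
    calc |haarPrim a x| ≤ (x - 1) ^ (a - 2) :=
          abs_haarPrim_le_of_one_lt ha0 (by linarith) (by linarith)
      _ ≤ ((n + 1 : ℝ) / 3) ^ (a - 2) :=
          Real.rpow_le_rpow_of_nonpos hb (by linarith) (by linarith)
      _ ≤ ((n + 1 : ℝ) / 3) ^ (h - 3 / 2) :=
          Real.rpow_le_rpow_of_exponent_le (by linarith) (by linarith)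
      _ = 3 ^ (3 / 2 - h) * (n + 1 : ℝ) ^ (h - 3 / 2) := by
          rw [Real.div_rpow (by positivity) (by norm_num),
            show 3 / 2 - h = -(h - 3 / 2) by ring, Real.rpow_neg (by norm_num)]
          field_simp
      _ ≤ 128 * (n + 1 : ℝ) ^ (h - 3 / 2) := by
          gcongr
          calc (3 : ℝ) ^ (3 / 2 - h) ≤ 3 ^ (2 : ℝ) :=
                Real.rpow_le_rpow_of_exponent_le (by norm_num) (by linarith)
            _ ≤ 128 := by norm_num
  · have hx2 : x < 2 := by
      have : (n : ℝ) ≤ 1 := by exact_mod_cast Nat.lt_succ_iff.1 h2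
      linarith
    have hF : ∀ y ≤ x, |truncPrim a y| ≤ 8 := by
      intro y hy
      have h0 : 0 ≤ truncPrim a y := by unfold truncPrim; positivity
      rw [abs_of_nonneg h0, truncPrim, div_le_iff₀ ha0]
      calc (max y 0) ^ a ≤ 2 ^ a :=
            Real.rpow_le_rpow (le_max_right _ _) (max_le (by linarith) zero_le_two) ha0.le
        _ ≤ 2 ^ (2 : ℝ) := Real.rpow_le_rpow_of_exponent_le (by norm_num) (by linarith)
        _ ≤ 8 * a := by norm_num; linarith
    have h1 : (1 / 4 : ℝ) ≤ ((n : ℝ) + 1) ^ (h - 3 / 2) := by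
      have hn2 : (n : ℝ) + 1 ≤ 2 := by exact_mod_cast h2
      calc (1 / 4 : ℝ) = 2 ^ (-2 : ℝ) := by
            rw [Real.rpow_neg zero_le_two]; norm_num
        _ ≤ 2 ^ (h - 3 / 2) := Real.rpow_le_rpow_of_exponent_le (by norm_num) (by linarith)
        _ ≤ ((n : ℝ) + 1) ^ (h - 3 / 2) :=
            Real.rpow_le_rpow_of_nonpos (by positivity) hn2 (by linarith)
    have f1 := abs_le.1 (hF x le_rfl)
    have f2 := abs_le.1 (hF (x - 1 / 2) (by linarith))
    have f3 := abs_le.1 (hF (x - 1) (by linarith))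
    have : |haarPrim a x| ≤ 32 := by
      rw [haarPrim, abs_le]; constructor <;> linarith [f1.1, f1.2, f2.1, f2.2, f3.1, f3.2]
    linarith

/-- The process is causal: the `(j, k)` term does not contribute before time `k / 2^j`. -/
lemma coef_of_le {H : ℕ → ℝ → ℝ} {j k : ℕ} (hk : k < 2 ^ j) (hH : 0 < H j (k / 2 ^ j)) {t : ℝ}
    (ht : t ≤ k / 2 ^ j) : coef H j k t = 0 := by
  rw [coef_eq hk hH, haarPrim_of_nonpos (by linarith), mul_zero]
  rw [le_div_iff₀ (by positivity)] at ht
  linarith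

lemma le_coef_midpoint {H : ℕ → ℝ → ℝ} {j k : ℕ} (hk : k < 2 ^ j) {p : ℝ}
    (hH : 0 < H j (k / 2 ^ j)) (hH' : H j (k / 2 ^ j) ≤ 1) (hp : H j (k / 2 ^ j) ≤ p) :
    2 ^ (-(j * p)) / 8 ≤ coef H j k ((k + 1 / 2) / 2 ^ j) := by
  rw [coef_eq hk hH, show (2 : ℝ) ^ j * ((k + 1 / 2) / 2 ^ j) - k = 1 / 2 by field_simp; ring,
    div_eq_mul_one_div]
  gcongr
  · norm_num
  · exact le_haarPrim_half (by linarith) (by linarith)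

/-- The squares of the coefficients of a level add up to at most a multiple of `2^(-2 j Hlow)`. -/
lemma exists_sum_coef_sq_le {H : ℕ → ℝ → ℝ} {Hlow Hupp : ℝ} (hlow : 0 < Hlow) (hupp : Hupp < 1)
    (hH : ∀ j, ∀ t ∈ Icc (0 : ℝ) 1, H j t ∈ Icc Hlow Hupp) {t : ℝ} (ht : 0 ≤ t) :
    ∃ K : ℝ, 0 ≤ K ∧ ∀ j, ∑ k : Fin (2 ^ j), coef H j k t ^ 2 ≤ K * (2 ^ (-(j * Hlow))) ^ 2 := by
  set g : ℕ → ℝ := fun n => (128 * ((n : ℝ) + 1) ^ (Hupp - 3 / 2)) ^ 2 with hg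
  have hg0 : ∀ n, 0 ≤ g n := fun n => sq_nonneg _
  have hgs : Summable g := by
    have h1 : Summable fun n : ℕ => ((n : ℝ) + 1) ^ (2 * Hupp - 3) := by
      have := (Real.summable_nat_rpow (p := 2 * Hupp - 3)).2 (by linarith)
      simpa using (summable_nat_add_iff 1).2 this
    refine (h1.mul_left (128 ^ 2)).congr fun n => ?_
    rw [hg]
    simp only
    rw [mul_pow, ← Real.rpow_natCast (_ ^ _) 2, ← Real.rpow_mul (by positivity)]
    congr 2
    push_cast; ring
  refine ⟨∑' n, g n, tsum_nonneg hg0, fun j => ?_⟩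
  set m := ⌊(2 : ℝ) ^ j * t⌋₊ with hm
  have hm1 : (m : ℝ) ≤ 2 ^ j * t := Nat.floor_le (by positivity)
  have hm2 : (2 : ℝ) ^ j * t < m + 1 := Nat.lt_floor_add_one _
  have hmem : ∀ k : ℕ, k < 2 ^ j → H j (k / 2 ^ j) ∈ Icc Hlow Hupp := fun k hk =>
    hH j _ ⟨by positivity, (div_le_one (by positivity)).2 (by exact_mod_cast hk.le)⟩
  -- The terms with `k > m` vanish and those with `k ≤ m` are reindexed by `n = m - k`.
  have hterm : ∀ k ∈ Finset.range (2 ^ j), coef H j k t ^ 2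
      ≤ if k ≤ m then (2 ^ (-(j * Hlow))) ^ 2 * g (m - k) else 0 := by
    intro k hk
    rw [Finset.mem_range] at hk
    obtain ⟨ha, hb⟩ := hmem k hk
    rw [coef_eq hk (by linarith), mul_pow]
    split_ifs with hkm
    · have hbd := abs_haarPrim_le (n := m - k) (a := H j (k / 2 ^ j) + 1 / 2) (h := Hupp)
        (x := 2 ^ j * t - k) (by linarith) (by linarith) hupp
        (by rw [Nat.cast_sub hkm]; linarith) (by rw [Nat.cast_sub hkm]; linarith)
      rw [← sq_abs (haarPrim _ _)]
      have : (2 : ℝ) ^ (-(j * H j (k / 2 ^ j))) ≤ 2 ^ (-(j * Hlow)) :=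
        Real.rpow_le_rpow_of_exponent_le (by norm_num) (by gcongr)
      exact mul_le_mul (pow_le_pow_left₀ (by positivity) this 2)
        (pow_le_pow_left₀ (abs_nonneg _) hbd 2) (sq_nonneg _) (sq_nonneg _)
    · have : (m : ℝ) + 1 ≤ k := by exact_mod_cast not_le.1 hkm
      rw [haarPrim_of_nonpos (by linarith) (by linarith)]
      simp
  rw [Fin.sum_univ_eq_sum_range (fun k => coef H j k t ^ 2)]
  refine (Finset.sum_le_sum hterm).trans ?_
  rw [← Finset.sum_filter, ← Finset.mul_sum, mul_comm]
  gcongr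
  have hinj : Set.InjOn (fun k => m - k)
      (((Finset.range (2 ^ j)).filter (· ≤ m) : Finset ℕ) : Set ℕ) := by
    intro a ha b hb hab
    simp only [Finset.coe_filter, mem_ofPred_eq] at ha hb hab
    omega
  rw [← Finset.sum_image (f := g) hinj]
  exact hgs.sum_le_tsum _ fun n _ => hg0 n

end GHBMP

namespace GHBMP

/-! ### Convergence of the series and dependence on a single coordinate -/

variable {Ω : Type*} [mΩ : MeasurableSpace Ω] {P : Measure Ω} {ε : Idx → Ω → ℝ}

lemma IsStdGaussianFamily.orthonormal [IsProbabilityMeasure P] (hε : IsStdGaussianFamily P ε) :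
    Orthonormal ℝ fun i => (hε.memLp i).toLp (ε i) := by
  classical
  have hint : ∀ i, ∫ ω, ε i ω ∂P = 0 := by
    intro i
    have := integral_map (hε.measurable i).aemeasurable (f := fun x : ℝ => x)
      aestronglyMeasurable_id (μ := P)
    rw [← this, hε.law i, integral_id_gaussianReal]
  rw [orthonormal_iff_ite]
  intro i i'
  rw [L2.inner_def]
  have hae : (fun ω => inner ℝ ((hε.memLp i).toLp (ε i) ω) ((hε.memLp i').toLp (ε i') ω))
      =ᵐ[P] fun ω => ε i ω * ε i' ω := by
    filter_upwards [(hε.memLp i).coeFn_toLp, (hε.memLp i').coeFn_toLp] with ω h h'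
    rw [h, h']
    simp [mul_comm]
  rw [integral_congr_ae hae]
  split_ifs with h
  · subst h
    have h1 : Var[ε i; P] = 1 := by
      have := variance_map (μ := P) (X := id) (Y := ε i) aemeasurable_id
        (hε.measurable i).aemeasurable
      rw [hε.law i, variance_id_gaussianReal] at this
      simpa using this.symm
    rw [variance_of_integral_eq_zero (hε.measurable i).aemeasurable (hint i)] at h1
    rw [← h1]
    exact integral_congr_ae (.of_forall fun ω => (sq (ε i ω)).symm)
  · rw [(hε.indep.indepFun h).integral_fun_mul_eq_mul_integral
      (hε.measurable i).aestronglyMeasurable (hε.measurable i').aestronglyMeasurable,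
      hint i, zero_mul]

/-- The levels of the series are absolutely summable in `L²(P)`, so that `seriesL2` is a genuine
sum. -/
lemma summable_seriesL2 [IsProbabilityMeasure P] (hε : IsStdGaussianFamily P ε)
    {H : ℕ → ℝ → ℝ} {Hlow Hupp : ℝ} (hlow : 0 < Hlow) (hupp : Hupp < 1)
    (hH : ∀ j, ∀ t ∈ Icc (0 : ℝ) 1, H j t ∈ Icc Hlow Hupp) {t : ℝ} (ht : 0 ≤ t) :
    Summable fun j : ℕ =>
      ∑ k : Fin (2 ^ j), coef H j k t • (hε.memLp ⟨j, k⟩).toLp (ε ⟨j, k⟩) := by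
  obtain ⟨K, hK, hbd⟩ := exists_sum_coef_sq_le hlow hupp hH ht
  have hgeo : Summable fun j : ℕ => √K * ((2 : ℝ) ^ (-Hlow)) ^ j := by
    refine (summable_geometric_of_lt_one (by positivity) ?_).mul_left _
    exact Real.rpow_lt_one_of_one_lt_of_neg one_lt_two (by linarith)
  refine Summable.of_norm_bounded hgeo fun j => ?_
  have horth : Orthonormal ℝ fun k : Fin (2 ^ j) => (hε.memLp ⟨j, k⟩).toLp (ε ⟨j, k⟩) :=
    hε.orthonormal.comp (fun k : Fin (2 ^ j) => (⟨j, k⟩ : Idx))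
      fun _ _ h => eq_of_heq (Sigma.mk.inj h).2
  have hsq : ‖∑ k : Fin (2 ^ j), coef H j k t • (hε.memLp ⟨j, k⟩).toLp (ε ⟨j, k⟩)‖ ^ 2
      = ∑ k : Fin (2 ^ j), coef H j k t ^ 2 := by
    rw [← real_inner_self_eq_norm_sq, horth.inner_sum]
    exact Finset.sum_congr rfl fun k _ => (sq (coef H j k t)).symm
  refine le_of_sq_le_sq ?_ (by positivity)
  rw [hsq, mul_pow, Real.sq_sqrt hK, ← Real.rpow_natCast (2 ^ (-Hlow)) j,
    ← Real.rpow_mul zero_le_two, show -Hlow * j = -(j * Hlow) by ring]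
  exact hbd j

/-- The information carried by all the coordinates of `ε` except the one of index `e`. -/
abbrev otherCoords (ε : Idx → Ω → ℝ) (e : Idx) : MeasurableSpace Ω :=
  ⨆ i ∈ ({e}ᶜ : Set Idx), MeasurableSpace.comap (ε i) inferInstance

lemma otherCoords_le (hε : IsStdGaussianFamily P ε) (e : Idx) : otherCoords ε e ≤ mΩ :=
  iSup₂_le fun i _ => (hε.measurable i).comap_le

lemma indep_otherCoords (hε : IsStdGaussianFamily P ε) (e : Idx) :
    Indep (otherCoords ε e) (MeasurableSpace.comap (ε e) inferInstance) P := by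
  have h := indep_iSup_of_disjoint (fun i => (hε.measurable i).comap_le) hε.indep
    (S := ({e}ᶜ : Set Idx)) (T := {e}) disjoint_compl_left
  simpa [otherCoords] using h

lemma aestronglyMeasurable_otherCoords (hε : IsStdGaussianFamily P ε) {e i : Idx} (h : i ≠ e) :
    AEStronglyMeasurable[otherCoords ε e] ((hε.memLp i).toLp (ε i)) P := by
  have h1 : Measurable[otherCoords ε e] (ε i) :=
    Measurable.mono (comap_measurable (ε i))
      (le_iSup₂ (f := fun i (_ : i ∈ ({e}ᶜ : Set Idx)) =>
        MeasurableSpace.comap (ε i) inferInstance) i h) le_rfl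
  exact ⟨ε i, h1.stronglyMeasurable, (hε.memLp i).coeFn_toLp⟩

/-- Removing the term of index `(j, k)` from the series leaves a random variable that is
determined by the other coordinates. -/
lemma aestronglyMeasurable_seriesL2_sub (hε : IsStdGaussianFamily P ε) {H : ℕ → ℝ → ℝ} {t : ℝ}
    (hs : Summable fun j : ℕ =>
      ∑ k : Fin (2 ^ j), coef H j k t • (hε.memLp ⟨j, k⟩).toLp (ε ⟨j, k⟩))
    (j : ℕ) (k : Fin (2 ^ j)) :
    AEStronglyMeasurable[otherCoords ε ⟨j, k⟩]
      (fun ω => seriesL2 H hε t ω - coef H j k t * ε ⟨j, k⟩ ω) P := by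
  classical
  have hm := otherCoords_le hε ⟨j, k⟩
  let V := lpMeas ℝ ℝ (otherCoords ε ⟨j, k⟩) 2 P
  have hV : IsClosed (V : Set (Lp ℝ 2 P)) :=
    isClosed_aestronglyMeasurable hm
  have hterm : ∀ i : Idx, i ≠ ⟨j, k⟩ → (hε.memLp i).toLp (ε i) ∈ V := fun i hi =>
    mem_lpMeas_iff_aestronglyMeasurable.2 (aestronglyMeasurable_otherCoords hε hi)
  have hsum := hs.hasSum.sub
    (hasSum_ite_eq j (coef H j k t • (hε.memLp ⟨j, k⟩).toLp (ε ⟨j, k⟩)))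
  have hmem : seriesL2 H hε t - coef H j k t • (hε.memLp ⟨j, k⟩).toLp (ε ⟨j, k⟩) ∈ V := by
    refine hV.mem_of_tendsto hsum (.of_forall fun s => V.sum_mem fun j' _ => ?_)
    split_ifs with h
    · subst h
      rw [← Finset.add_sum_erase _ _ (Finset.mem_univ k), add_sub_cancel_left]
      refine V.sum_mem fun k' hk' => V.smul_mem _ (hterm _ fun h => ?_)
      exact Finset.ne_of_mem_erase hk' (eq_of_heq (Sigma.mk.inj h).2)
    · rw [sub_zero]
      refine V.sum_mem fun k' _ => V.smul_mem _ (hterm _ fun h' => ?_)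
      exact h (congrArg Sigma.fst h')
  refine (mem_lpMeas_iff_aestronglyMeasurable.1 hmem).congr ?_
  filter_upwards [Lp.coeFn_sub (seriesL2 H hε t)
    (coef H j k t • (hε.memLp ⟨j, k⟩).toLp (ε ⟨j, k⟩)),
    Lp.coeFn_smul (coef H j k t) ((hε.memLp ⟨j, k⟩).toLp (ε ⟨j, k⟩)),
    (hε.memLp ⟨j, k⟩).coeFn_toLp] with ω h1 h2 h3
  rw [h1, Pi.sub_apply, h2, Pi.smul_apply, h3, smul_eq_mul]

/-! ### Small ball estimates -/

lemma gaussianReal_le_volume : gaussianReal 0 1 ≤ volume := by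
  rw [gaussianReal_of_var_ne_zero _ one_ne_zero]
  conv_rhs => rw [← withDensity_one (μ := (volume : Measure ℝ))]
  refine withDensity_mono (.of_forall fun x => ?_)
  rw [gaussianPDF, Pi.one_apply, ENNReal.ofReal_le_one, gaussianPDFReal]
  refine mul_le_one₀ (inv_le_one_of_one_le₀ ?_) (Real.exp_nonneg _) (Real.exp_le_one_iff.2 ?_)
  · rw [Real.one_le_sqrt]
    simp only [NNReal.coe_one, mul_one]
    linarith [Real.pi_gt_three]
  · exact div_nonpos_of_nonpos_of_nonneg (neg_nonpos.2 (sq_nonneg _)) (by positivity)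

lemma gaussianReal_abs_le {c η : ℝ} (hc : 0 < c) (y : ℝ) :
    gaussianReal 0 1 {z | |c * z + y| ≤ η} ≤ ENNReal.ofReal (2 * η / c) := by
  have hsub : {z | |c * z + y| ≤ η} ⊆ Icc ((-η - y) / c) ((η - y) / c) := by
    intro z hz
    obtain ⟨h1, h2⟩ := abs_le.1 (show |c * z + y| ≤ η from hz)
    exact ⟨(div_le_iff₀' hc).2 (by linarith), (le_div_iff₀' hc).2 (by linarith)⟩
  refine (gaussianReal_le_volume _).trans ((measure_mono hsub).trans ?_)
  rw [Real.volume_Icc]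
  exact (congrArg ENNReal.ofReal (by ring)).le

/-- Adding an independent summand `Y` does not increase the bound on the probability that a
Gaussian variable `c Z` is small, even on an event `A` independent of `Z`. -/
lemma measure_inter_abs_le {Ω : Type*} {𝒢 : MeasurableSpace Ω} [mΩ : MeasurableSpace Ω]
    {P : Measure Ω} [IsProbabilityMeasure P] (hG : 𝒢 ≤ mΩ)
    {Z Y : Ω → ℝ} (hZ : Measurable Z) (hlaw : P.map Z = gaussianReal 0 1)
    (hind : Indep 𝒢 (MeasurableSpace.comap Z inferInstance) P) {A : Set Ω}
    (hA : MeasurableSet[𝒢] A) (hY : Measurable[𝒢] Y) {c η : ℝ} (hc : 0 < c) :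
    P (A ∩ {ω | |c * Z ω + Y ω| ≤ η}) ≤ P A * ENNReal.ofReal (2 * η / c) := by
  let f : Ω → ℝ × ℝ := fun ω => (Y ω, A.indicator (fun _ => 1) ω)
  have hf : Measurable[𝒢] f := hY.prodMk (measurable_const.indicator hA)
  have hf' : Measurable f := hf.mono hG le_rfl
  have hfZ : IndepFun f Z P :=
    (IndepFun_iff_Indep f Z P).2 (indep_of_indep_of_le_left hind hf.comap_le)
  let S : Set ((ℝ × ℝ) × ℝ) := {q | q.1.2 = 1 ∧ |c * q.2 + q.1.1| ≤ η}
  have hS : MeasurableSet S := by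
    refine MeasurableSet.inter ?_ ?_
    · exact measurableSet_eq_fun (f := fun q : (ℝ × ℝ) × ℝ => q.1.2) (by fun_prop)
        measurable_const
    · exact measurableSet_le (f := fun q : (ℝ × ℝ) × ℝ => |c * q.2 + q.1.1|) (by fun_prop)
        measurable_const
  let B : Set (ℝ × ℝ) := {w | w.2 = 1}
  have hB : MeasurableSet B := measurableSet_eq_fun measurable_snd measurable_const
  have hAB : f ⁻¹' B = A := by
    ext ω
    by_cases h : ω ∈ A <;> simp [f, B, h]
  have hpre : A ∩ {ω | |c * Z ω + Y ω| ≤ η} = (fun ω => (f ω, Z ω)) ⁻¹' S := by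
    conv_lhs => rw [← hAB]
    rfl
  rw [hpre, ← Measure.map_apply (hf'.prodMk hZ) hS,
    (indepFun_iff_map_prod_eq_prod_map_map hf'.aemeasurable hZ.aemeasurable).1 hfZ, hlaw,
    Measure.prod_apply hS]
  calc ∫⁻ w, gaussianReal 0 1 (Prod.mk w ⁻¹' S) ∂(P.map f)
      ≤ ∫⁻ w, B.indicator (fun _ => ENNReal.ofReal (2 * η / c)) w ∂(P.map f) := by
        refine lintegral_mono fun w => ?_
        by_cases hw : w ∈ B
        · rw [indicator_of_mem hw]
          exact (measure_mono fun z hz => hz.2).trans (gaussianReal_abs_le hc w.1)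
        · rw [indicator_of_notMem hw, show Prod.mk w ⁻¹' S = ∅ from
            eq_empty_of_forall_notMem fun z hz => hw hz.1, measure_empty]
    _ = P A * ENNReal.ofReal (2 * η / c) := by
        rw [lintegral_indicator_const hB, Measure.map_apply hf' hB, hAB, mul_comm]

/-- Small ball estimate for a triangular array: each `D m` contains a multiple of a Gaussian
variable `Z m` that is independent of the rest of `D m` and of `D i`, `i < m`. -/
lemma measure_forall_abs_le_le_pow [IsProbabilityMeasure P] {D Z : ℕ → Ω → ℝ}
    {𝒢 : ℕ → MeasurableSpace Ω} (hG : ∀ m, 𝒢 m ≤ mΩ) (hZ : ∀ m, Measurable (Z m))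
    (hlaw : ∀ m, P.map (Z m) = gaussianReal 0 1)
    (hind : ∀ m, Indep (𝒢 m) (MeasurableSpace.comap (Z m) inferInstance) P) {N : ℕ} {c η : ℝ}
    (hc : 0 < c) (hη : 0 ≤ η) (hD : ∀ m < N, ∀ i < m, AEStronglyMeasurable[𝒢 m] (D i) P)
    (hDZ : ∀ m < N, ∃ c' ≥ c, AEStronglyMeasurable[𝒢 m] (fun ω => D m ω - c' * Z m ω) P) :
    P {ω | ∀ i < N, |D i ω| ≤ η} ≤ ENNReal.ofReal (2 * η / c) ^ N := by
  suffices h : ∀ m ≤ N, P {ω | ∀ i < m, |D i ω| ≤ η} ≤ ENNReal.ofReal (2 * η / c) ^ m from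
    h N le_rfl
  intro m
  induction m with
  | zero => intro _; simp
  | succ m ih =>
    intro hm
    obtain ⟨c', hc', Y, hY, hYe⟩ := hDZ m hm
    choose! D' hD' hDe using hD m hm
    let A : Set Ω := ⋂ i ∈ Finset.range m, D' i ⁻¹' {x | |x| ≤ η}
    have hA : MeasurableSet[𝒢 m] A := by
      refine @Finset.measurableSet_biInter _ _ (𝒢 m) _ _ fun i hi => ?_
      exact (hD' i (Finset.mem_range.1 hi)).measurable
        (measurableSet_le measurable_id.abs measurable_const)
    have hae : ∀ᵐ ω ∂P, ∀ i < m, D i ω = D' i ω := by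
      rw [ae_all_iff]; intro i
      by_cases hi : i < m
      · filter_upwards [hDe i hi] with ω h _ using h
      · exact .of_forall fun ω h => absurd h hi
    have hle : P {ω | ∀ i < m + 1, |D i ω| ≤ η} ≤ P (A ∩ {ω | |c' * Z m ω + Y ω| ≤ η}) := by
      refine measure_mono_ae ?_
      filter_upwards [hae, hYe] with ω h1 h2 h
      have h : ∀ i < m + 1, |D i ω| ≤ η := h
      refine ⟨?_, ?_⟩
      · simp only [A, mem_iInter, Finset.mem_range]
        intro i hi
        change |D' i ω| ≤ η
        rw [← h1 i hi]
        exact h i (by omega)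
      · change |c' * Z m ω + Y ω| ≤ η
        rw [← h2, add_sub_cancel]
        exact h m (by omega)
    have hAle : P A ≤ P {ω | ∀ i < m, |D i ω| ≤ η} := by
      refine measure_mono_ae ?_
      filter_upwards [hae] with ω h1 h
      have h : ω ∈ A := h
      simp only [A, mem_iInter, Finset.mem_range] at h
      intro i hi
      rw [h1 i hi]
      exact h i hi
    refine hle.trans ((measure_inter_abs_le (hG m) (hZ m) (hlaw m) (hind m) hA hY.measurable
      (hc.trans_le hc')).trans ?_)
    rw [pow_succ]
    gcongr
    exact hAle.trans (ih (by omega))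

/-- The half-cell increments over `N` consecutive dyadic intervals of level `j`, on which
`H j ≤ p`, are simultaneously small only with a small probability: the increment over the `i`-th
cell is the first one to involve the coordinate of that cell. -/
lemma measure_increments_le [IsProbabilityMeasure P] (hε : IsStdGaussianFamily P ε)
    {H : ℕ → ℝ → ℝ} {Hlow Hupp : ℝ} (hlow : 0 < Hlow) (hupp : Hupp < 1)
    (hH : ∀ j, ∀ t ∈ Icc (0 : ℝ) 1, H j t ∈ Icc Hlow Hupp) {X : ℝ → Ω → ℝ}
    (hX : IsGHBMP H hε X) {j k N : ℕ} (hk : k + N ≤ 2 ^ j) {p η : ℝ} (hη : 0 ≤ η)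
    (hp : ∀ i < N, H j ((k + i : ℕ) / 2 ^ j) ≤ p) :
    P {ω | ∀ i < N, |X (((k + i : ℕ) + 1 / 2) / 2 ^ j) ω - X ((k + i : ℕ) / 2 ^ j) ω| ≤ η}
      ≤ ENNReal.ofReal (16 * η * 2 ^ (j * p)) ^ N := by
  have h2j : (0 : ℝ) < 2 ^ j := by positivity
  -- Reduction modulo `2 ^ j` only serves to make the index total.
  let e : ℕ → Fin (2 ^ j) := fun m => ⟨(k + m) % 2 ^ j, Nat.mod_lt _ (by positivity)⟩
  have he : ∀ m < N, ((e m : ℕ) = k + m) := fun m hm => Nat.mod_eq_of_lt (by omega)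
  have hmem : ∀ m < N, H j ((k + m : ℕ) / 2 ^ j) ∈ Icc Hlow Hupp := fun m hm =>
    hH j _ ⟨by positivity, (div_le_one h2j).2 (by exact_mod_cast (by omega : k + m ≤ 2 ^ j))⟩
  have hX' : ∀ m < N, ∀ t ∈ Icc (0 : ℝ) 1, AEStronglyMeasurable[otherCoords ε ⟨j, e m⟩]
      (fun ω => X t ω - coef H j (k + m) t * ε ⟨j, e m⟩ ω) P := by
    intro m hm t ht
    have h := aestronglyMeasurable_seriesL2_sub hε (summable_seriesL2 hε hlow hupp hH ht.1) j (e m)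
    rw [he m hm] at h
    refine h.congr ?_
    filter_upwards [hX t ht] with ω hω
    rw [hω]
  have hX0 : ∀ m < N, ∀ t ∈ Icc (0 : ℝ) 1, t ≤ (k + m : ℕ) / 2 ^ j →
      AEStronglyMeasurable[otherCoords ε ⟨j, e m⟩] (X t) P := by
    intro m hm t ht htm
    have h := hX' m hm t ht
    rw [coef_of_le (by omega) (hlow.trans_le (hmem m hm).1) htm] at h
    simpa using h
  have ht1 : ∀ i < N, ((k + i : ℕ) / 2 ^ j : ℝ) ∈ Icc (0 : ℝ) 1 := fun i hi =>
    ⟨by positivity, (div_le_one h2j).2 (by exact_mod_cast (by omega : k + i ≤ 2 ^ j))⟩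
  have ht2 : ∀ i < N, (((k + i : ℕ) + 1 / 2) / 2 ^ j : ℝ) ∈ Icc (0 : ℝ) 1 := by
    intro i hi
    refine ⟨by positivity, (div_le_one h2j).2 ?_⟩
    have : ((k + i : ℕ) : ℝ) + 1 ≤ 2 ^ j := by exact_mod_cast (by omega : k + i + 1 ≤ 2 ^ j)
    linarith
  have hconst : 16 * η * (2 : ℝ) ^ (j * p) = 2 * η / (2 ^ (-(j * p)) / 8) := by
    rw [Real.rpow_neg zero_le_two]
    field_simp
    ring
  rw [hconst]
  refine measure_forall_abs_le_le_pow (Z := fun m => ε ⟨j, e m⟩)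
    (D := fun i ω => X (((k + i : ℕ) + 1 / 2) / 2 ^ j) ω - X ((k + i : ℕ) / 2 ^ j) ω)
    (𝒢 := fun m => otherCoords ε ⟨j, e m⟩)
    (fun m => otherCoords_le hε _) (fun m => hε.measurable _) (fun m => hε.law _)
    (fun m => indep_otherCoords hε _) (by positivity) hη ?_ ?_
  · intro m hm i hi
    have hlt : ((k + i : ℕ) : ℝ) + 1 ≤ (k + m : ℕ) := by exact_mod_cast (by omega)
    refine (hX0 m hm _ (ht2 i (hi.trans hm)) ?_).sub (hX0 m hm _ (ht1 i (hi.trans hm)) ?_)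
    · gcongr; linarith
    · gcongr
  · intro m hm
    refine ⟨coef H j (k + m) (((k + m : ℕ) + 1 / 2) / 2 ^ j),
      le_coef_midpoint (by omega) (hlow.trans_le (hmem m hm).1)
        ((hmem m hm).2.trans hupp.le) (hp m hm), ?_⟩
    refine ((hX' m hm _ (ht2 m hm)).sub (hX0 m hm _ (ht1 m hm) le_rfl)).congr ?_
    exact .of_forall fun ω => by simp only [Pi.sub_apply]; ring

end GHBMP

namespace GHBMP

/-! ### Almost sure lower bound for the oscillation -/

variable {Ω : Type*} [mΩ : MeasurableSpace Ω] {P : Measure Ω} {ε : Idx → Ω → ℝ}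

/-- If `N (q - p) ≥ 2`, then almost surely, at all large levels `j`, every run of `N` consecutive
dyadic intervals on which `H j ≤ p` contains a half-cell increment larger than
`2 (N / 2^j)^q`. -/
lemma ae_eventually_exists_increment_gt [IsProbabilityMeasure P] (hε : IsStdGaussianFamily P ε)
    {H : ℕ → ℝ → ℝ} {Hlow Hupp : ℝ} (hlow : 0 < Hlow) (hupp : Hupp < 1)
    (hH : ∀ j, ∀ t ∈ Icc (0 : ℝ) 1, H j t ∈ Icc Hlow Hupp) {X : ℝ → Ω → ℝ}
    (hX : IsGHBMP H hε X) {p q : ℝ} {N : ℕ} (hN : 2 ≤ N * (q - p)) :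
    ∀ᵐ ω ∂P, ∀ᶠ j : ℕ in atTop, ∀ k : ℕ, k + N ≤ 2 ^ j →
      (∀ i < N, H j ((k + i : ℕ) / 2 ^ j) ≤ p) →
      ∃ i < N, 2 * (N / 2 ^ j : ℝ) ^ q
        < |X (((k + i : ℕ) + 1 / 2) / 2 ^ j) ω - X ((k + i : ℕ) / 2 ^ j) ω| := by
  have hN0 : 0 < N := by
    rcases Nat.eq_zero_or_pos N with h | h
    · subst h; norm_num at hN
    · exact h
  let E : ℕ → ℕ → Set Ω := fun j k => {ω | (k + N ≤ 2 ^ j ∧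
    ∀ i < N, H j ((k + i : ℕ) / 2 ^ j) ≤ p) ∧ ∀ i < N,
      |X (((k + i : ℕ) + 1 / 2) / 2 ^ j) ω - X ((k + i : ℕ) / 2 ^ j) ω| ≤ 2 * (N / 2 ^ j : ℝ) ^ q}
  set K : ℝ := (32 * (N : ℝ) ^ q) ^ N with hK
  have hreal : ∀ j : ℕ, (16 * (2 * (N / 2 ^ j : ℝ) ^ q) * 2 ^ (j * p)) ^ N
      ≤ K * ((1 / 2) ^ j * (1 / 2) ^ j) := by
    intro j
    have h1 : (16 * (2 * (N / 2 ^ j : ℝ) ^ q) * 2 ^ (j * p))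
        = 32 * (N : ℝ) ^ q * 2 ^ (-(j * (q - p))) := by
      rw [Real.div_rpow (by positivity) (by positivity), ← Real.rpow_natCast 2 j,
        ← Real.rpow_mul zero_le_two, show -((j : ℝ) * (q - p)) = -(j * q) + j * p by ring,
        Real.rpow_add two_pos, Real.rpow_neg zero_le_two, div_eq_mul_inv]
      ring
    rw [h1, mul_pow, hK]
    gcongr
    rw [← Real.rpow_natCast (2 ^ _) N, ← Real.rpow_mul zero_le_two, ← mul_pow]
    calc (2 : ℝ) ^ (-(j * (q - p)) * N) ≤ 2 ^ (-(2 * j : ℝ)) := by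
          apply Real.rpow_le_rpow_of_exponent_le one_le_two
          have : (0 : ℝ) ≤ j := Nat.cast_nonneg j
          nlinarith
      _ = (1 / 2 * (1 / 2)) ^ j := by
          rw [Real.rpow_neg zero_le_two, Real.rpow_mul zero_le_two, Real.rpow_natCast]
          norm_num [← inv_pow]
  have hE : ∀ j k, P (E j k) ≤ ENNReal.ofReal (K * ((1 / 2) ^ j * (1 / 2) ^ j)) := by
    intro j k
    by_cases h : k + N ≤ 2 ^ j ∧ ∀ i < N, H j ((k + i : ℕ) / 2 ^ j) ≤ p
    · refine (measure_mono fun ω hω => hω.2).trans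
        ((measure_increments_le hε hlow hupp hH hX h.1 (by positivity) h.2).trans ?_)
      rw [← ENNReal.ofReal_pow (by positivity)]
      exact ENNReal.ofReal_le_ofReal (hreal j)
    · rw [show E j k = ∅ from eq_empty_of_forall_notMem fun ω hω => h hω.1, measure_empty]
      exact zero_le
  have hU : ∀ j, P (⋃ k ∈ Finset.range (2 ^ j), E j k) ≤ ENNReal.ofReal (K * (1 / 2) ^ j) := by
    intro j
    refine (measure_biUnion_finset_le _ _).trans ((Finset.sum_le_sum fun k _ => hE j k).trans ?_)
    rw [Finset.sum_const, Finset.card_range, nsmul_eq_mul, ← ENNReal.ofReal_natCast,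
      ← ENNReal.ofReal_mul (by positivity)]
    refine ENNReal.ofReal_le_ofReal (le_of_eq ?_)
    have : (2 : ℝ) ^ j * (1 / 2) ^ j = 1 := by rw [← mul_pow]; norm_num
    push_cast
    linear_combination K * (1 / 2) ^ j * this
  have hsum : ∑' j, P (⋃ k ∈ Finset.range (2 ^ j), E j k) ≠ ∞ := by
    refine ne_top_of_le_ne_top ?_ (ENNReal.tsum_le_tsum hU)
    exact (summable_geometric_two.mul_left K).tsum_ofReal_ne_top
  filter_upwards [ae_eventually_notMem hsum] with ω hω
  filter_upwards [hω] with j hj k hk hp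
  by_contra! hcon
  refine hj (mem_biUnion (x := k) ?_ ⟨⟨hk, hp⟩, hcon⟩)
  simp only [Finset.coe_range, mem_Iio]
  omega

lemma abs_sub_le_of_lipNorm_le {f : ℝ → ℝ} {L : ℝ} (hL : 0 ≤ L)
    (h : lipNorm f ≤ ENNReal.ofReal L) {x y : ℝ} (hx : x ∈ Icc (0 : ℝ) 1)
    (hy : y ∈ Icc (0 : ℝ) 1) : |f y - f x| ≤ L * |y - x| := by
  wlog hxy : x < y generalizing x y
  · rcases (not_lt.1 hxy).eq_or_lt with rfl | hlt
    · simp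
    · rw [abs_sub_comm, abs_sub_comm y]
      exact this hy hx hlt
  have h1 : ENNReal.ofReal (|f y - f x| / (y - x)) ≤ ENNReal.ofReal L := by
    refine le_trans ?_ (le_add_self.trans h)
    exact le_iSup₂_of_le x hx (le_iSup₂_of_le y hy (le_iSup_of_le hxy le_rfl))
  rwa [ENNReal.ofReal_le_ofReal_iff hL, div_le_iff₀ (sub_pos.2 hxy),
    ← abs_of_pos (sub_pos.2 hxy)] at h1

/-- A pointwise Hölder exponent exceeding `q` controls the increments from `t` by the power `q`. -/
lemma exists_abs_sub_le_of_lt_holderExponent {x : ℝ → ℝ} {t q : ℝ} (hq : 0 < q)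
    (h : ENNReal.ofReal q < holderExponent x t) :
    ∃ δ > 0, ∀ s ∈ Icc (0 : ℝ) 1, |s - t| < δ → |x s - x t| ≤ |s - t| ^ q := by
  rw [holderExponent] at h
  simp only [lt_iSup_iff] at h
  obtain ⟨α, hα, hqα⟩ := h
  have hqα : q < α := by
    rwa [← ENNReal.ofReal_coe_nnreal,
      ENNReal.ofReal_lt_ofReal_iff_of_nonneg hq.le] at hqα
  have hev := eventually_lt_of_limsup_lt (hα.trans_lt (zero_lt_one (α := ℝ≥0∞)))
  rw [eventually_nhdsWithin_iff, Metric.eventually_nhds_iff] at hev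
  obtain ⟨δ, hδ, hev⟩ := hev
  refine ⟨min δ 1, lt_min hδ one_pos, fun s hs hst => ?_⟩
  rcases eq_or_ne s t with rfl | hne
  · rw [sub_self, abs_zero]; positivity
  have hne' : s - t ≠ 0 := sub_ne_zero.2 hne
  have h1 := @hev (s - t) (by simpa using hst.trans_le (min_le_left _ _))
    ⟨hne', by simpa using hs⟩
  rw [add_sub_cancel, ENNReal.ofReal_lt_one, div_lt_one (by positivity)] at h1
  exact h1.le.trans (Real.rpow_le_rpow_of_exponent_ge (by positivity)
    (hst.le.trans (min_le_right _ _)) hqα.le)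

/-- The pathwise part of the argument: at infinitely many levels `H j t < p`, the Lipschitz bound
carries this over, with a slightly larger `p`, to the cells near `t`, and one of these has a
large increment. -/
lemma holderExponent_le_hurst {H : ℕ → ℝ → ℝ} {Hlow Hupp C : ℝ} (hlow : 0 < Hlow) (hC : 0 < C)
    (hH : ∀ j, ∀ t ∈ Icc (0 : ℝ) 1, H j t ∈ Icc Hlow Hupp)
    (hlip : ∀ j : ℕ, lipNorm (H j) ≤ ENNReal.ofReal (C * (1 + j))) {x : ℝ → ℝ} {N : ℚ → ℚ → ℕ}
    (hx : ∀ p q : ℚ, p < q → 0 < N p q ∧ ∀ᶠ j : ℕ in atTop, ∀ k : ℕ, k + N p q ≤ 2 ^ j →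
      (∀ i < N p q, H j ((k + i : ℕ) / 2 ^ j) ≤ p) →
      ∃ i < N p q, 2 * (N p q / 2 ^ j : ℝ) ^ (q : ℝ)
        < |x (((k + i : ℕ) + 1 / 2) / 2 ^ j) - x ((k + i : ℕ) / 2 ^ j)|)
    {t : ℝ} (ht : t ∈ Ioo (0 : ℝ) 1) :
    holderExponent x t ≤ ENNReal.ofReal (hurst H t) := by
  have htI : t ∈ Icc (0 : ℝ) 1 := Ioo_subset_Icc_self ht
  have hcob : IsCoboundedUnder (· ≥ ·) atTop fun j => H j t :=
    IsBoundedUnder.isCoboundedUnder_ge ⟨Hupp, by simpa using ⟨0, fun j _ => (hH j t htI).2⟩⟩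
  have hbelow : Hlow ≤ hurst H t :=
    le_liminf_of_le hcob (.of_forall fun j => (hH j t htI).1)
  by_contra! hlt
  obtain ⟨α, hα, hαlt⟩ := ENNReal.lt_iff_exists_nnreal_btwn.1 hlt
  have hα : hurst H t < α := by
    rwa [← ENNReal.ofReal_coe_nnreal,
      ENNReal.ofReal_lt_ofReal_iff_of_nonneg (hlow.le.trans hbelow)] at hα
  obtain ⟨q, hq1, hq2⟩ := exists_rat_btwn hα
  obtain ⟨p, hp1, hp2⟩ := exists_rat_btwn hq1
  obtain ⟨p', hp'1, hp'2⟩ := exists_between hp1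
  have hq0 : (0 : ℝ) < q := by linarith
  obtain ⟨δ, hδ, hxδ⟩ := exists_abs_sub_le_of_lt_holderExponent hq0 (lt_of_le_of_lt
    (by rw [← ENNReal.ofReal_coe_nnreal]; exact ENNReal.ofReal_le_ofReal hq2.le) hαlt)
  obtain ⟨hN0, hinc⟩ := hx p q (by exact_mod_cast hp2)
  generalize N p q = n at hN0 hinc
  have hn1 : (1 : ℝ) ≤ n := by exact_mod_cast hN0
  have lim0 : Tendsto (fun j : ℕ => (n : ℝ) / 2 ^ j) atTop (𝓝 0) :=
    tendsto_const_nhds.div_atTop (tendsto_pow_atTop_atTop_of_one_lt one_lt_two)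
  have lim1 : Tendsto (fun j : ℕ => C * (1 + j) * ((n : ℝ) / 2 ^ j)) atTop (𝓝 0) := by
    have h := (tendsto_pow_const_div_const_pow_of_one_lt 1 (one_lt_two (α := ℝ))).const_mul (C * n)
    have h' := lim0.const_mul C
    have := h'.add h
    simp only [mul_zero, add_zero, pow_one] at this
    exact this.congr fun j => by ring
  obtain ⟨j, hjp', hjδ, hj1, hjC, hj⟩ := ((frequently_lt_of_liminf_lt hcob hp'1).and_eventually
    ((lim0.eventually_lt_const hδ).and ((lim0.eventually_lt_const (sub_pos.2 ht.2)).and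
    ((lim1.eventually_lt_const (sub_pos.2 hp'2)).and hinc)))).exists
  have h2j : (0 : ℝ) < 2 ^ j := by positivity
  have hk1 : (⌊(2 : ℝ) ^ j * t⌋₊ : ℝ) ≤ 2 ^ j * t := Nat.floor_le (by have := ht.1; positivity)
  have hk2 : (2 : ℝ) ^ j * t < ⌊(2 : ℝ) ^ j * t⌋₊ + 1 := Nat.lt_floor_add_one _
  set k := ⌊(2 : ℝ) ^ j * t⌋₊
  rw [div_lt_iff₀ h2j] at hj1
  have hkn : (k : ℝ) + n ≤ 2 ^ j := by nlinarith
  -- All the points in use are at distance at most `n / 2 ^ j` from `t`.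
  have hpt : ∀ z : ℝ, 0 ≤ z → z ≤ n →
      (k + z) / 2 ^ j ∈ Icc (0 : ℝ) 1 ∧ |(k + z) / 2 ^ j - t| ≤ n / 2 ^ j := by
    intro z hz0 hzn
    refine ⟨⟨by positivity, (div_le_one h2j).2 (by linarith)⟩, ?_⟩
    rw [show (k + z) / 2 ^ j - t = (k + z - 2 ^ j * t) / 2 ^ j by field_simp, abs_div,
      abs_of_pos h2j]
    gcongr
    rw [abs_le]
    constructor <;> linarith
  have hinc' : ∀ z : ℝ, 0 ≤ z → z ≤ n →
      |x ((k + z) / 2 ^ j) - x t| ≤ (n / 2 ^ j : ℝ) ^ (q : ℝ) := by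
    intro z hz0 hzn
    obtain ⟨h1, h2⟩ := hpt z hz0 hzn
    exact (hxδ _ h1 (h2.trans_lt hjδ)).trans (Real.rpow_le_rpow (abs_nonneg _) h2 hq0.le)
  obtain ⟨i, hi, hgt⟩ := hj k (by exact_mod_cast hkn) fun i hi => by
    obtain ⟨h1, h2⟩ := hpt i (by positivity) (by exact_mod_cast hi.le)
    rw [Nat.cast_add]
    have h3 := abs_sub_le_of_lipNorm_le (by positivity) (hlip j) htI h1
    have h4 : C * (1 + j) * |(k + i) / 2 ^ j - t| ≤ C * (1 + j) * ((n : ℝ) / 2 ^ j) := by gcongr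
    linarith [(abs_le.1 h3).2]
  have hi' : (i : ℝ) + 1 ≤ n := by exact_mod_cast hi
  have h1 := abs_le.1 (hinc' (i + 1 / 2) (by positivity) (by linarith))
  have h2 := abs_le.1 (hinc' i (by positivity) (by linarith))
  rw [Nat.cast_add, add_assoc] at hgt
  refine hgt.not_ge (abs_le.2 ⟨?_, ?_⟩) <;> linarith [h1.1, h1.2, h2.1, h2.2]

end GHBMP

theorem mainTheorem3 {Ω : Type*} [MeasurableSpace Ω] (P : Measure Ω) [IsProbabilityMeasure P]
    (ε : GHBMP.Idx → Ω → ℝ) (hε : GHBMP.IsStdGaussianFamily P ε)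
    (Hlow Hupp : ℝ) (hlow : 0 < Hlow) (hupp : Hupp < 1)
    (H : ℕ → ℝ → ℝ)
    (hH : ∀ j, ∀ t ∈ Icc (0 : ℝ) 1, H j t ∈ Icc Hlow Hupp)
    (C : ℝ) (hC : 0 < C)
    (hlip : ∀ j : ℕ, GHBMP.lipNorm (H j) ≤ ENNReal.ofReal (C * (1 + j)))
    (hhurst : ∀ t ∈ Ioo (0 : ℝ) 1, GHBMP.hurst H t < Hlow + 1 / 2)
    (X : ℝ → Ω → ℝ) (hX : GHBMP.IsGHBMP H hε X) :
    ∃ Ω₂ : Set Ω, MeasurableSet Ω₂ ∧ P Ω₂ = 1 ∧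
      ∀ ω ∈ Ω₂, ∀ t ∈ Ioo (0 : ℝ) 1,
        GHBMP.holderExponent (fun s => X s ω) t ≤ ENNReal.ofReal (GHBMP.hurst H t) := by

  let N : ℚ → ℚ → ℕ := fun p q => ⌈2 / ((q : ℝ) - p)⌉₊
  have hN : ∀ p q : ℚ, p < q → 2 ≤ N p q * ((q : ℝ) - p) := fun p q hpq => by
    have : (0 : ℝ) < q - p := sub_pos.2 (by exact_mod_cast hpq)
    exact (div_le_iff₀ this).1 (Nat.le_ceil _)
  have hN0 : ∀ p q : ℚ, p < q → 0 < N p q := fun p q hpq =>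
    Nat.ceil_pos.2 (div_pos two_pos (sub_pos.2 (by exact_mod_cast hpq)))
  have hae : ∀ᵐ ω ∂P, ∀ p q : ℚ, p < q → ∀ᶠ j : ℕ in atTop, ∀ k : ℕ, k + N p q ≤ 2 ^ j →
      (∀ i < N p q, H j ((k + i : ℕ) / 2 ^ j) ≤ p) →
      ∃ i < N p q, 2 * (N p q / 2 ^ j : ℝ) ^ (q : ℝ)
        < |X (((k + i : ℕ) + 1 / 2) / 2 ^ j) ω - X ((k + i : ℕ) / 2 ^ j) ω| := by
    simp only [ae_all_iff]
    exact fun p q hpq =>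
      GHBMP.ae_eventually_exists_increment_gt hε hlow hupp hH hX (hN p q hpq)
  obtain ⟨S, hSsub, hSmeas, hS⟩ := exists_measurable_superset_of_null (ae_iff.1 hae)
  refine ⟨Sᶜ, hSmeas.compl, (prob_compl_eq_one_iff hSmeas).2 hS, fun ω hω t ht => ?_⟩
  have hgood := not_not.1 fun h => hω (hSsub h)
  exact GHBMP.holderExponent_le_hurst hlow hC hH hlip
    (fun p q hpq => ⟨hN0 p q hpq, hgood p q hpq⟩) ht
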